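/- Theorem (Asymptotic classification of states). Let $\rho$ and $\sigma$ be states (density matrices) on a quantum system with Hilbert space $\mathbb{C}^d$. Write $S(\rho) = -\mathrm{Tr}[\rho\log\rho]$ for the von Neumann entropy and $\|X\|_1 = \mathrm{Tr}\sqrt{X^\dagger X}$ for the trace norm, let the size of a finite-dimensional system be the logarithm of its Hilbert space dimension (the number of qubits), and let logarithms be to base $2$. Then the following are equivalent: 1. $S(\rho) = S(\sigma)$. 2. There exist, for each $n\in\mathbb{N}$, a finite-dimensional ancilla system, of size $O(\sqrt{n\log n})$ as $n\to\infty$, a state $\eta_n$ of the ancilla, and a unitary $U_n$ on the joint system consisting of $(\mathbb{C}^d)^{\otimes n}$ and the ancilla, such that $$\left\| \mathrm{Tr}_{\mathrm{anc}}\left[U_n(\rho^{\otimes n}\otimes\eta_n)U_n^\dagger\right] - \sigma^{\otimes n}\right\|_1 \xrightarrow{n\to\infty} 0.$$ 3. There exist, for each $n\in\mathbb{N}$, a finite-dimensional ancilla system, of size $o(n)$ as $n\to\infty$, states $\eta_n$ and $\nu_n$ of the ancilla, and unitaries $U_n$ and $V_n$ on the joint system consisting of $(\mathbb{C}^d)^{\otimes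 n}$ and the ancilla, such that $$\left\| \mathrm{Tr}_{\mathrm{anc}}\left[U_n(\rho^{\otimes n}\otimes\eta_n)U_n^\dagger - V_n(\sigma^{\otimes n}\otimes\nu_n)V_n^\dagger\right]\right\|_1 \xrightarrow{n\to\infty} 0.$$ -/

import Mathlib

open Filter Topology Asymptotics
open scoped Kronecker Matrix ComplexOrder

/-- A (mixed) state of a finite-dimensional quantum system, as a density matrix with respect to an
orthonormal basis indexed by `ι`: positive semidefinite with unit trace. -/
structure IsState {ι : Type*} [Fintype ι] (ρ : Matrix ι ι ℂ) : Prop where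
  posSemidef : ρ.PosSemidef
  trace_eq_one : ρ.trace = 1

/-- The von Neumann entropy `S(ρ) = - Tr (ρ log ρ)` in bits; the logarithm of the matrix is taken by
the functional calculus, with the convention `0 log 0 = 0`. -/
noncomputable def vonNeumannEntropy {ι : Type*} [Fintype ι] [DecidableEq ι]
    (ρ : Matrix ι ι ℂ) : ℝ :=
  -(ρ * cfc (Real.logb 2) ρ).trace.re

/-- The trace norm `‖X‖₁ = Tr √(X† X)`. -/
noncomputable def traceNorm {ι : Type*} [Fintype ι] [DecidableEq ι] (X : Matrix ι ι ℂ) : ℝ :=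
  (cfc Real.sqrt (Xᴴ * X)).trace.re

/-- The `n`-fold tensor power `ρ ⊗ ⋯ ⊗ ρ`, with respect to the product basis, which is indexed by
the `n`-tuples of basis labels. -/
def tensorPower {ι : Type*} (ρ : Matrix ι ι ℂ) (n : ℕ) : Matrix (Fin n → ι) (Fin n → ι) ℂ :=
  Matrix.of fun i j => ∏ k, ρ (i k) (j k)

/-- The partial trace over the second tensor factor (the ancilla). -/
def traceAnc {ι κ : Type*} [Fintype κ] (X : Matrix (ι × κ) (ι × κ) ℂ) : Matrix ι ι ℂ :=
  Matrix.of fun i j => ∑ a, X (i, a) (j, a)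

/-- The size of a system with Hilbert space dimension `D`: the number of qubits `log₂ D`. -/
noncomputable def systemSize (D : ℕ) : ℝ := Real.logb 2 D

/-! ### Product distributions and typical sequences -/

/-! Everything reduces to the spectra `p`, `q` of the two states and to typical sequences.
Chebyshev's inequality with window w = √(n log n) leaves atypical mass at most Var / log n, which
tends to 0, while w = o(n). A typical sequence of `p` has probability 2^(-nS ± w), and there are at
most 2^(nS + w) of them (`sum_notMem_typicalSet_le`, `card_typicalSet_le`).

For equal entropies, an ancilla uniform on K = 2^m of its K² levels, with m = ⌈3w⌉, cuts the typical
atoms of `p` into grains much smaller than the typical atoms of `q`. The grains are packed greedily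
into bins whose capacities are the atoms of `q`; each bin receives at most K² grains, so the packing
extends to a permutation of the joint eigenbasis (`exists_perm_redistribute`). Conjugated by the
eigenbases, this permutation is the unitary wanted (`exists_unitary_traceNorm_eq`).

Conversely, suppose S(ρ) < S(σ) and the ancilla has dimension D. Up to small mass, the reduced state
coming from ρ has rank at most D² 2^(nS(ρ) + w), while the one coming from σ is bounded by D
2^(-nS(σ) + w) times the identity. The support projection of the former tells them apart with an
error of exponent -n(S(σ) - S(ρ)) + 2w + 3 log D, which tends to -∞ when log D = o(n)
(`le_traceNorm_traceAnc_sub`). The condition is symmetric in the two states, so both strict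
inequalities are excluded. -/

theorem sum_fin_succ_pi {ι : Type*} [Fintype ι] (n : ℕ) (F : (Fin (n + 1) → ι) → ℝ) :
    ∑ x, F x = ∑ a, ∑ y : Fin n → ι, F (Fin.cons a y) := by
  rw [← Fintype.sum_prod_type']
  exact (Equiv.sum_comp (Fin.consEquiv fun _ => ι) F).symm

theorem sum_prod_eq_one {ι : Type*} [Fintype ι] {p : ι → ℝ} (hp : ∑ i, p i = 1) (n : ℕ) :
    ∑ x : Fin n → ι, ∏ k, p (x k) = 1 := by
  induction n with
  | zero => simp
  | succ n ih =>
    rw [sum_fin_succ_pi]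
    simp [Fin.prod_univ_succ, ← Finset.mul_sum, ih, hp]

theorem sum_prod_mul_sum_eq_zero {ι : Type*} [Fintype ι] {p g : ι → ℝ} (hp : ∑ i, p i = 1)
    (hg : ∑ i, p i * g i = 0) (n : ℕ) :
    ∑ x : Fin n → ι, (∏ k, p (x k)) * ∑ k, g (x k) = 0 := by
  induction n with
  | zero => simp
  | succ n ih =>
    rw [sum_fin_succ_pi]
    have h (a : ι) : ∑ y : Fin n → ι, (∏ k, p ((Fin.cons a y : Fin (n + 1) → ι) k)) *
        ∑ k, g ((Fin.cons a y : Fin (n + 1) → ι) k) = p a * g a := by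
      calc _ = ∑ y : Fin n → ι, ((p a * g a) * (∏ k, p (y k)) +
            p a * ((∏ k, p (y k)) * ∑ k, g (y k))) := by
            refine Finset.sum_congr rfl fun y _ => ?_
            simp only [Fin.prod_univ_succ, Fin.sum_univ_succ, Fin.cons_zero, Fin.cons_succ]
            ring
        _ = _ := by
            rw [Finset.sum_add_distrib, ← Finset.mul_sum, ← Finset.mul_sum, ih,
              sum_prod_eq_one hp]
            ring
    simp_rw [h, hg]

/-- Variances of independent variables add: expanding the square one coordinate at a time, the cross
term vanishes because `g` has mean zero. -/
theorem sum_prod_mul_sum_sq {ι : Type*} [Fintype ι] {p g : ι → ℝ} (hp : ∑ i, p i = 1)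
    (hg : ∑ i, p i * g i = 0) (n : ℕ) :
    ∑ x : Fin n → ι, (∏ k, p (x k)) * (∑ k, g (x k)) ^ 2 = n * ∑ i, p i * g i ^ 2 := by
  induction n with
  | zero => simp
  | succ n ih =>
    rw [sum_fin_succ_pi]
    have h (a : ι) : ∑ y : Fin n → ι, (∏ k, p ((Fin.cons a y : Fin (n + 1) → ι) k)) *
        (∑ k, g ((Fin.cons a y : Fin (n + 1) → ι) k)) ^ 2 =
          p a * g a ^ 2 + p a * (n * ∑ i, p i * g i ^ 2) := by
      calc _ = ∑ y : Fin n → ι, ((p a * g a ^ 2) * (∏ k, p (y k)) +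
            (2 * p a * g a) * ((∏ k, p (y k)) * ∑ k, g (y k)) +
            p a * ((∏ k, p (y k)) * (∑ k, g (y k)) ^ 2)) := by
            refine Finset.sum_congr rfl fun y _ => ?_
            simp only [Fin.prod_univ_succ, Fin.sum_univ_succ, Fin.cons_zero, Fin.cons_succ]
            ring
        _ = _ := by
            rw [Finset.sum_add_distrib, Finset.sum_add_distrib, ← Finset.mul_sum,
              ← Finset.mul_sum, ← Finset.mul_sum, ih, sum_prod_eq_one hp,
              sum_prod_mul_sum_eq_zero hp hg]
            ring
    simp_rw [h, Finset.sum_add_distrib, ← Finset.sum_mul, hp]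
    push_cast
    ring

/-- The Shannon entropy, in bits. -/
noncomputable def shannonEntropy {ι : Type*} [Fintype ι] (p : ι → ℝ) : ℝ :=
  ∑ i, p i * -Real.logb 2 (p i)

/-- The variance of the information content `-log₂ p`. -/
noncomputable def varentropy {ι : Type*} [Fintype ι] (p : ι → ℝ) : ℝ :=
  ∑ i, p i * (-Real.logb 2 (p i) - shannonEntropy p) ^ 2

/-- The sequences whose probability is within a factor `2 ^ c` of `2 ^ (-n S)`. -/
noncomputable def typicalSet {ι : Type*} [Fintype ι] (p : ι → ℝ) (n : ℕ) (c : ℝ) :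
    Finset (Fin n → ι) :=
  {x | (2 : ℝ) ^ (-(n * shannonEntropy p) - c) ≤ ∏ k, p (x k) ∧
    ∏ k, p (x k) ≤ (2 : ℝ) ^ (-(n * shannonEntropy p) + c)}

/-- Chebyshev's inequality for the information content, which is a sum of n independent copies of
`-log₂ p`. -/
theorem sum_notMem_typicalSet_le {ι : Type*} [Fintype ι] [DecidableEq ι] {p : ι → ℝ}
    (hp0 : ∀ i, 0 ≤ p i) (hp : ∑ i, p i = 1) (n : ℕ) {c : ℝ} (hc : 0 < c) :
    ∑ x ∈ (typicalSet p n c)ᶜ, ∏ k, p (x k) ≤ n * varentropy p / c ^ 2 := by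
  set S := shannonEntropy p with hS
  set g : ι → ℝ := fun i => -Real.logb 2 (p i) - S with hg
  have hg0 : ∑ i, p i * g i = 0 := by
    simp only [hg, mul_sub, Finset.sum_sub_distrib, ← Finset.sum_mul, hp]
    simp [hS, shannonEntropy]
  have hP0 (x : Fin n → ι) : 0 ≤ ∏ k, p (x k) := Finset.prod_nonneg fun _ _ => hp0 _
  rw [le_div_iff₀ (by positivity), Finset.sum_mul]
  refine le_trans ?_ (sum_prod_mul_sum_sq hp hg0 n).le
  refine le_trans (Finset.sum_le_sum fun x hx => ?_)
    (Finset.sum_le_sum_of_subset_of_nonneg (Finset.subset_univ _)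
      fun x _ _ => mul_nonneg (hP0 x) (sq_nonneg _))
  -- Sequences of probability zero lie outside the window but carry no mass; only for the others
  -- does the logarithm of the product split.
  rcases (hP0 x).eq_or_lt with h0 | h0
  · simp [← h0]
  refine mul_le_mul_of_nonneg_left ?_ h0.le
  have hpk (k) : p (x k) ≠ 0 := fun h => h0.ne' (Finset.prod_eq_zero (Finset.mem_univ k) h)
  have hsum : ∑ k, g (x k) = -Real.logb 2 (∏ k, p (x k)) - n * S := by
    rw [Real.logb_prod _ _ fun k _ => hpk k]
    simp [hg, Finset.sum_sub_distrib]
  by_contra! hlt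
  have habs := abs_lt_of_sq_lt_sq hlt hc.le
  rw [hsum] at habs
  refine (Finset.mem_compl.1 hx) ?_
  simp only [typicalSet, Finset.mem_filter, Finset.mem_univ, true_and]
  constructor
  · rw [← Real.le_logb_iff_rpow_le (by norm_num) h0]; linarith [(abs_lt.1 habs).2]
  · rw [← Real.logb_le_iff_le_rpow (by norm_num) h0]; linarith [(abs_lt.1 habs).1]

/-- Each typical sequence has at least the lower window probability, and the total mass is 1. -/
theorem card_typicalSet_le {ι : Type*} [Fintype ι] {p : ι → ℝ}
    (hp0 : ∀ i, 0 ≤ p i) (hp : ∑ i, p i = 1) (n : ℕ) (c : ℝ) :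
    ((typicalSet p n c).card : ℝ) ≤ 2 ^ (n * shannonEntropy p + c) := by
  have h1 : ((typicalSet p n c).card : ℝ) * 2 ^ (-(n * shannonEntropy p) - c) ≤ 1 := by
    rw [← nsmul_eq_mul]
    refine le_trans (Finset.card_nsmul_le_sum _ (fun x => ∏ k, p (x k)) _ fun x hx => ?_) ?_
    · exact (Finset.mem_filter.1 hx).2.1
    · rw [← sum_prod_eq_one hp n]
      exact Finset.sum_le_sum_of_subset_of_nonneg (Finset.subset_univ _)
        fun x _ _ => Finset.prod_nonneg fun _ _ => hp0 _
  have h2 : (0 : ℝ) < 2 ^ (n * shannonEntropy p + c) := by positivity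
  have h3 : (2 : ℝ) ^ (-(n * shannonEntropy p) - c) = (2 ^ (n * shannonEntropy p + c))⁻¹ := by
    rw [← Real.rpow_neg (by norm_num)]; congr 1; ring
  rw [h3] at h1
  rwa [← div_eq_mul_inv, div_le_one h2] at h1

/-! ### Redistributing the atoms of a distribution -/

/-- Greedy bin packing, by induction on the atoms; the value `none` means unplaced. As soon as an
atom fits in no bin, every bin is within `m` of being full, and later loads only grow. Hence either
everything is placed or all bins are nearly full. -/
theorem exists_greedy_assignment {X Y : Type*} [DecidableEq X] [DecidableEq Y]
    (a : Y → ℝ) (m : ℝ) (q : X → ℝ) (G : Finset X) (hq : ∀ x ∈ G, 0 ≤ q x) (T : Finset Y)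
    (ha0 : ∀ y ∈ T, 0 ≤ a y) (ham : ∀ y ∈ T, a y ≤ m) :
    ∃ f : Y → Option X, (∀ y x, f y = some x → y ∈ T ∧ x ∈ G) ∧
      (∀ x ∈ G, ∑ y ∈ T with f y = some x, a y ≤ q x) ∧
      ((∀ y ∈ T, f y ≠ none) ∨ ∀ x ∈ G, q x - m ≤ ∑ y ∈ T with f y = some x, a y) := by
  induction T using Finset.induction_on with
  | empty => exact ⟨fun _ => none, by simp, by simpa using hq, by simp⟩
  | insert y₀ T hy₀ ih =>
    obtain ⟨f, hf1, hf2, hf3⟩ := ih (fun y hy => ha0 y (Finset.mem_insert_of_mem hy))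
      fun y hy => ham y (Finset.mem_insert_of_mem hy)
    have hfy₀ : f y₀ = none := by
      cases h : f y₀ with
      | none => rfl
      | some x => exact absurd (hf1 _ _ h).1 hy₀
    by_cases hx : ∃ x ∈ G, ∑ y ∈ T with f y = some x, a y + a y₀ ≤ q x
    · obtain ⟨x₀, hx₀, hle⟩ := hx
      have hload (x : X) : ∑ y ∈ insert y₀ T with Function.update f y₀ (some x₀) y = some x, a y =
          (if x₀ = x then a y₀ else 0) + ∑ y ∈ T with f y = some x, a y := by
        rw [Finset.sum_filter, Finset.sum_insert hy₀, Finset.sum_filter]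
        congr 1
        · simp
        · refine Finset.sum_congr rfl fun y hy => ?_
          rw [Function.update_of_ne (ne_of_mem_of_not_mem hy hy₀)]
      refine ⟨Function.update f y₀ (some x₀), fun y x h => ?_, fun x hx => ?_, ?_⟩
      · by_cases hy : y = y₀
        · subst hy
          rw [Function.update_self, Option.some.injEq] at h
          exact ⟨Finset.mem_insert_self _ _, h ▸ hx₀⟩
        · rw [Function.update_of_ne hy] at h
          exact ⟨Finset.mem_insert_of_mem (hf1 _ _ h).1, (hf1 _ _ h).2⟩
      · rw [hload]
        split_ifs with h
        · subst h; linarith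
        · linarith [hf2 x hx]
      · rcases hf3 with h | h
        · refine Or.inl fun y hy => ?_
          by_cases hyy : y = y₀
          · simp [hyy]
          · rw [Function.update_of_ne hyy]
            exact h y (Finset.mem_of_mem_insert_of_ne hy hyy)
        · refine Or.inr fun x hx => ?_
          rw [hload]
          split_ifs
          · linarith [h x hx, ha0 y₀ (Finset.mem_insert_self _ _)]
          · linarith [h x hx]
    · push Not at hx
      have hload (x : X) : ∑ y ∈ insert y₀ T with f y = some x, a y =
          ∑ y ∈ T with f y = some x, a y := by
        rw [Finset.filter_insert, if_neg (by simp [hfy₀])]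
      refine ⟨f, fun y x h => ⟨Finset.mem_insert_of_mem (hf1 _ _ h).1, (hf1 _ _ h).2⟩,
        fun x hx => (hload x).trans_le (hf2 x hx), Or.inr fun x hxG => ?_⟩
      rw [hload]
      linarith [hx x hxG, ham y₀ (Finset.mem_insert_self _ _)]

/-- Each class of `f` injects into its own block of `D` slots. The resulting partial injection
extends to a bijection because the two sides have equal cardinality. -/
theorem exists_equiv_fst_eq {X Y : Type*} [Fintype X] [Fintype Y] [DecidableEq X] [DecidableEq Y]
    {D : ℕ} (hY : Fintype.card Y = Fintype.card X * D) (hD : 0 < D) (T : Finset Y)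
    (f : Y → Option X) (hcard : ∀ x, (T.filter fun y => f y = some x).card ≤ D) :
    ∃ g : Y ≃ X × Fin D, ∀ y ∈ T, ∀ x, f y = some x → (g y).1 = x := by
  rcases isEmpty_or_nonempty X with hX | ⟨⟨x₀⟩⟩
  · refine ⟨Fintype.equivOfCardEq (by simpa using hY), fun y _ x => hX.elim x⟩
  have hinj (x : X) : ∃ i : Y → Fin D, Set.InjOn i (T.filter fun y => f y = some x) := by
    obtain ⟨e⟩ := Function.Embedding.nonempty_of_card_le
      (α := {y // y ∈ T.filter fun y => f y = some x}) (β := Fin D) (by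
        rw [Fintype.card_coe, Fintype.card_fin]; exact hcard x)
    refine ⟨fun y => if h : y ∈ T.filter fun y => f y = some x then e ⟨y, h⟩ else ⟨0, hD⟩,
      fun y hy z hz hyz => ?_⟩
    simp only [Finset.mem_coe] at hy hz
    simp only [dif_pos hy, dif_pos hz] at hyz
    exact congrArg Subtype.val (e.injective hyz)
  choose i hi using hinj
  -- The default `x₀` is harmless: only the restriction of `e` to assigned elements of `T` is
  -- extended.
  let e : Y → X × Fin D := fun y => ((f y).getD x₀, i ((f y).getD x₀) y)
  obtain ⟨g, hg⟩ := Finset.exists_equiv_extend_of_card_eq (t := (Finset.univ : Finset (X × Fin D)))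
    (by simpa using hY) (s := T.filter fun y => f y ≠ none) (f := e) (Finset.subset_univ _) (by
      intro y hy z hz hyz
      simp only [Finset.coe_filter, Set.mem_ofPred_eq, ne_eq, Option.ne_none_iff_exists] at hy hz
      obtain ⟨hyT, x, hx⟩ := hy
      obtain ⟨hzT, x', hx'⟩ := hz
      simp only [e, ← hx, ← hx', Option.getD_some, Prod.mk.injEq] at hyz
      obtain ⟨rfl, h⟩ := hyz
      exact hi x (by simp [hyT, hx]) (by simp [hzT, hx']) h)
  refine ⟨g.trans (Equiv.subtypeUnivEquiv fun _ => Finset.mem_univ _), fun y hy x hx => ?_⟩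
  have := hg y (by simp [hy, hx])
  simp [Equiv.subtypeUnivEquiv, this, e, hx]

/-- `L` is mass common to `R` and `Q`, so each exceeds it by total mass `1 - ∑ L`. -/
theorem sum_abs_sub_le {X : Type*} [Fintype X] {R Q L : X → ℝ} (hR : ∑ x, R x = 1)
    (hQ : ∑ x, Q x = 1) (hLR : ∀ x, L x ≤ R x) (hLQ : ∀ x, L x ≤ Q x) :
    ∑ x, |R x - Q x| ≤ 2 * (1 - ∑ x, L x) := by
  calc _ ≤ ∑ x, ((R x - L x) + (Q x - L x)) := Finset.sum_le_sum fun x _ => by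
        rw [abs_le]; constructor <;> linarith [hLR x, hLQ x]
    _ = _ := by simp only [Finset.sum_add_distrib, Finset.sum_sub_distrib, hR, hQ]; ring

/-- The uniform distribution on the first `K` of `D` points. -/
noncomputable def uniformWeight (K D : ℕ) (k : Fin D) : ℝ := if k.val < K then (K : ℝ)⁻¹ else 0

theorem uniformWeight_nonneg (K D : ℕ) (k : Fin D) : 0 ≤ uniformWeight K D k := by
  unfold uniformWeight; split_ifs <;> positivity

theorem card_filter_val_lt {K D : ℕ} (h : K ≤ D) :
    (Finset.univ.filter fun k : Fin D => k.val < K).card = K := by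
  rw [Fin.card_filter_val_lt, min_eq_right h]

theorem sum_uniformWeight {K D : ℕ} (hK : 0 < K) (h : K ≤ D) : ∑ k, uniformWeight K D k = 1 := by
  simp only [uniformWeight]
  rw [← Finset.sum_filter, Finset.sum_const, card_filter_val_lt h, nsmul_eq_mul,
    mul_inv_cancel₀ (by positivity)]

/-- The grains are the typical atoms of `P` divided by `K`, and the bins are the typical atoms of
`Q`. The term `ε` accounts for atypical mass and `u / K / l` for unfilled capacity: at most `1 / l`
bins, each short by at most `u / K`. -/
theorem exists_perm_redistribute {X : Type*} [Fintype X] [DecidableEq X] {P Q : X → ℝ}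
    (hP0 : ∀ x, 0 ≤ P x) (hQ0 : ∀ x, 0 ≤ Q x) (hP : ∑ x, P x = 1) (hQ : ∑ x, Q x = 1)
    {TP TQ : Finset X} {l u ε : ℝ} (hl : 0 < l) (hu : 0 ≤ u)
    (hTP : ∀ x ∈ TP, l ≤ P x ∧ P x ≤ u) (hTQ : ∀ x ∈ TQ, l ≤ Q x ∧ Q x ≤ u)
    (hεP : ∑ x ∈ TPᶜ, P x ≤ ε) (hεQ : ∑ x ∈ TQᶜ, Q x ≤ ε)
    {K D : ℕ} (hK : 0 < K) (hKD : K ≤ D) (hD : K * u ≤ l * D) :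
    ∃ g : X × Fin D ≃ X × Fin D,
      ∑ x, |∑ k, P (g (x, k)).1 * uniformWeight K D (g (x, k)).2 - Q x| ≤
        2 * (ε + u / K / l) := by
  have hK' : (0 : ℝ) < K := by exact_mod_cast hK
  set w : X × Fin D → ℝ := fun y => P y.1 * uniformWeight K D y.2 with hw
  have hw0 (y) : 0 ≤ w y := mul_nonneg (hP0 _) (uniformWeight_nonneg _ _ _)
  have hw1 : ∑ y, w y = 1 := by
    rw [Fintype.sum_prod_type]
    simp [hw, ← Finset.mul_sum, sum_uniformWeight hK hKD, hP]
  set T : Finset (X × Fin D) := TP ×ˢ (Finset.univ.filter fun k : Fin D => k.val < K) with hT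
  have hwT (y) (hy : y ∈ T) : w y = P y.1 / K ∧ y.1 ∈ TP := by
    simp only [hT, Finset.mem_product, Finset.mem_filter, Finset.mem_univ, true_and] at hy
    exact ⟨by simp [hw, uniformWeight, hy.2, div_eq_mul_inv], hy.1⟩
  have hwTsum : 1 - ε ≤ ∑ y ∈ T, w y := by
    have h1 : ∑ y ∈ T, w y = ∑ x ∈ TP, P x := by
      rw [Finset.sum_congr rfl fun y hy => (hwT y hy).1, hT, Finset.sum_product]
      simp only [Finset.sum_const, card_filter_val_lt hKD, nsmul_eq_mul]
      exact Finset.sum_congr rfl fun x _ => mul_div_cancel₀ _ hK'.ne'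
    have h2 := Finset.sum_add_sum_compl TP P
    linarith
  obtain ⟨f, hf1, hf2, hf3⟩ := exists_greedy_assignment w (u / K) Q TQ (fun x _ => hQ0 x) T
    (fun y _ => hw0 y) fun y hy => by
      rw [(hwT y hy).1]
      exact div_le_div_of_nonneg_right (hTP _ (hwT y hy).2).2 hK'.le
  set L : X → ℝ := fun x => ∑ y ∈ T with f y = some x, w y with hL
  have hLQ (x) : L x ≤ Q x := by
    by_cases hx : x ∈ TQ
    · exact hf2 x hx
    · refine le_of_eq_of_le (Finset.sum_eq_zero fun y hy => ?_) (hQ0 x)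
      exact absurd (hf1 y x (Finset.mem_filter.1 hy).2).2 hx
  -- A bin has capacity at most `u` and a grain weighs at least `l / K`, so a bin holds at most `K *
  -- u / l ≤ D` grains.
  have hcard (x) : (T.filter fun y => f y = some x).card ≤ D := by
    by_cases hx : x ∈ TQ
    · have h1 : (T.filter fun y => f y = some x).card • (l / K) ≤ L x := by
        refine Finset.card_nsmul_le_sum _ _ _ fun y hy => ?_
        have hy' := hwT y (Finset.mem_filter.1 hy).1
        rw [hy'.1]
        exact div_le_div_of_nonneg_right (hTP _ hy'.2).1 hK'.le
      have h2 := h1.trans ((hLQ x).trans (hTQ x hx).2)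
      rw [nsmul_eq_mul, mul_div_assoc', div_le_iff₀ hK'] at h2
      have h3 : l * ((T.filter fun y => f y = some x).card : ℝ) ≤ l * D := by linarith
      exact_mod_cast le_of_mul_le_mul_left h3 hl
    · rw [Finset.filter_false_of_mem fun y _ h => hx (hf1 y x h).2]
      simp
  obtain ⟨g, hg⟩ := exists_equiv_fst_eq (D := D) (by simp) (hK.trans_le hKD) T f hcard
  refine ⟨g.symm, ?_⟩
  -- The extension to a bijection may put further atoms into block `x`; these only add mass.
  have hLR (x) : L x ≤ ∑ k, w (g.symm (x, k)) := by
    have h1 : ∑ k, w (g.symm (x, k)) = ∑ y, if (g y).1 = x then w y else 0 := by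
      rw [← Equiv.sum_comp g.symm, Fintype.sum_prod_type]
      simp [Finset.sum_ite_eq']
    rw [h1, ← Finset.sum_filter]
    refine Finset.sum_le_sum_of_subset_of_nonneg (fun y hy => ?_) fun y _ _ => hw0 y
    rw [Finset.mem_filter] at hy
    simp [hg y hy.1 x hy.2]
  have hR : ∑ x, ∑ k, w (g.symm (x, k)) = 1 := by
    rw [← Fintype.sum_prod_type', ← hw1]
    exact Equiv.sum_comp g.symm w
  refine (sum_abs_sub_le hR hQ hLR hLQ).trans (mul_le_mul_of_nonneg_left ?_ zero_le_two)
  have hεu : 0 ≤ u / K / l := by positivity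
  rcases hf3 with h | h
  · have : ∑ x, L x = ∑ y ∈ T, w y := by
      simp only [hL, Finset.sum_filter]
      rw [Finset.sum_comm]
      refine Finset.sum_congr rfl fun y hy => ?_
      obtain ⟨x, hx⟩ := Option.ne_none_iff_exists.1 (h y hy)
      simp [← hx]
    linarith
  · have h1 : ∑ x ∈ TQ, (Q x - u / K) ≤ ∑ x, L x :=
      (Finset.sum_le_sum h).trans (Finset.sum_le_sum_of_subset_of_nonneg (Finset.subset_univ _)
        fun x _ _ => Finset.sum_nonneg fun y _ => hw0 y)
    have h2 := Finset.sum_add_sum_compl TQ Q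
    have h3 : TQ.card • l ≤ 1 := by
      rw [← hQ]
      exact (Finset.card_nsmul_le_sum _ _ _ fun x hx => (hTQ x hx).1).trans
        (Finset.sum_le_sum_of_subset_of_nonneg (Finset.subset_univ _) fun x _ _ => hQ0 x)
    rw [nsmul_eq_mul, ← le_div_iff₀ hl] at h3
    rw [Finset.sum_sub_distrib, Finset.sum_const, nsmul_eq_mul] at h1
    have h4 : (TQ.card : ℝ) * (u / K) ≤ u / K / l := by
      rw [div_eq_mul_one_div (u / K) l, mul_comm]
      exact mul_le_mul_of_nonneg_left h3 (by positivity)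
    linarith

/-! ### Diagonalization and the trace norm -/

set_option linter.unusedSectionVars false

section Diagonalization

variable {ι : Type*} [Fintype ι] [DecidableEq ι]

/-- The Hermitian matrix with eigenvectors the columns of `W` and eigenvalues `v`. -/
def ofEigen (W : Matrix ι ι ℂ) (v : ι → ℝ) : Matrix ι ι ℂ :=
  W * Matrix.diagonal (fun i => (v i : ℂ)) * Wᴴ

theorem Matrix.IsHermitian.exists_ofEigen {A : Matrix ι ι ℂ} (hA : A.IsHermitian) :
    ∃ W ∈ Matrix.unitaryGroup ι ℂ, A = ofEigen W hA.eigenvalues :=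
  ⟨hA.eigenvectorUnitary, hA.eigenvectorUnitary.2, by
    conv_lhs => rw [hA.spectral_theorem, Unitary.conjStarAlgAut_apply]
    rfl⟩

theorem trace_ofEigen {W : Matrix ι ι ℂ} (hW : W ∈ Matrix.unitaryGroup ι ℂ) (v : ι → ℝ) :
    (ofEigen W v).trace = ((∑ i, v i : ℝ) : ℂ) := by
  rw [ofEigen, Matrix.trace_mul_cycle, ← Matrix.star_eq_conjTranspose,
    Matrix.mem_unitaryGroup_iff'.1 hW]
  simp [Matrix.trace_diagonal]

theorem ofEigen_mul_ofEigen {W : Matrix ι ι ℂ} (hW : W ∈ Matrix.unitaryGroup ι ℂ) (v w : ι → ℝ) :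
    ofEigen W v * ofEigen W w = ofEigen W (fun i => v i * w i) := by
  have h : Wᴴ * W = 1 := Matrix.mem_unitaryGroup_iff'.1 hW
  calc _ = W * Matrix.diagonal (fun i => (v i : ℂ)) * (Wᴴ * W) *
        Matrix.diagonal (fun i => (w i : ℂ)) * Wᴴ := by simp only [ofEigen, Matrix.mul_assoc]
    _ = _ := by simp [h, ofEigen, Matrix.mul_assoc, ← Matrix.diagonal_mul_diagonal]

theorem conjTranspose_ofEigen (W : Matrix ι ι ℂ) (v : ι → ℝ) :
    (ofEigen W v)ᴴ = ofEigen W v := by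
  have h : star (fun i => (v i : ℂ)) = fun i => (v i : ℂ) := by ext i; simp
  simp only [ofEigen, Matrix.conjTranspose_mul, Matrix.conjTranspose_conjTranspose,
    Matrix.diagonal_conjTranspose, h, Matrix.mul_assoc]

theorem ofEigen_posSemidef (W : Matrix ι ι ℂ) {v : ι → ℝ} (hv : ∀ i, 0 ≤ v i) :
    (ofEigen W v).PosSemidef :=
  (Matrix.PosSemidef.diagonal fun i => by simpa using hv i).mul_mul_conjTranspose_same W

theorem ofEigen_sub (W : Matrix ι ι ℂ) (v w : ι → ℝ) :
    ofEigen W v - ofEigen W w = ofEigen W (v - w) := by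
  simp [ofEigen, ← Matrix.sub_mul, ← Matrix.mul_sub, Matrix.diagonal_sub]

theorem ofEigen_add (W : Matrix ι ι ℂ) (v w : ι → ℝ) :
    ofEigen W v + ofEigen W w = ofEigen W (v + w) := by
  simp [ofEigen, ← Matrix.add_mul, ← Matrix.mul_add, Matrix.diagonal_add]

theorem ofEigen_one {W : Matrix ι ι ℂ} (hW : W ∈ Matrix.unitaryGroup ι ℂ) :
    ofEigen W (fun _ => 1) = 1 := by
  simp [ofEigen]
  exact Matrix.mem_unitaryGroup_iff.1 hW

/-- Diagonal matrices in the basis of columns of `W`, as an algebra homomorphism. -/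
noncomputable def ofEigenAlgHom {W : Matrix ι ι ℂ} (hW : W ∈ Matrix.unitaryGroup ι ℂ) :
    (ι → ℝ) →ₐ[ℝ] Matrix ι ι ℂ :=
  AlgHom.ofLinearMap
    { toFun := ofEigen W
      map_add' := fun v w => (ofEigen_add W v w).symm
      map_smul' := fun r v => by
        have h : Matrix.diagonal (fun i => (((r • v) i : ℝ) : ℂ)) =
            r • Matrix.diagonal (fun i => (v i : ℂ)) := by
          rw [← Matrix.diagonal_smul]
          congr 1
          ext i
          simp
        simp only [ofEigen, h, Matrix.mul_smul, Matrix.smul_mul, RingHom.id_apply] }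
    (ofEigen_one hW) fun v w => (ofEigen_mul_ofEigen hW v w).symm

/-- On a finite set of nodes `f` agrees with a polynomial, and polynomials commute with the algebra
homomorphism `ofEigenAlgHom`. -/
theorem cfc_ofEigen {W : Matrix ι ι ℂ} (hW : W ∈ Matrix.unitaryGroup ι ℂ) (v : ι → ℝ)
    (f : ℝ → ℝ) : cfc f (ofEigen W v) = ofEigen W (f ∘ v) := by
  have hA : IsSelfAdjoint (ofEigen W v) := conjTranspose_ofEigen W v
  -- Taking both the spectrum and the values of `v` as nodes avoids proving that they coincide.
  let s : Finset ℝ := (Matrix.finite_real_spectrum (A := ofEigen W v)).toFinset ∪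
    Finset.univ.image v
  let q := Lagrange.interpolate s id f
  have hq (x : ℝ) (hx : x ∈ s) : q.eval x = f x :=
    Lagrange.eval_interpolate_at_node f Function.injective_id.injOn hx
  have hv : Polynomial.aeval v q = f ∘ v := by
    ext i
    have h := Polynomial.aeval_algHom_apply (Pi.evalAlgHom ℝ (fun _ : ι => ℝ) i) v q
    rw [Pi.evalAlgHom_apply, Pi.evalAlgHom_apply, Polynomial.coe_aeval_eq_eval] at h
    rw [← h, hq _ (by simp [s]), Function.comp_apply]
  calc cfc f (ofEigen W v) = cfc q.eval (ofEigen W v) :=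
        cfc_congr fun x hx => (hq x (by simp [s, hx])).symm
    _ = Polynomial.aeval (ofEigenAlgHom hW v) q := cfc_polynomial q _ hA
    _ = ofEigenAlgHom hW (f ∘ v) := by rw [Polynomial.aeval_algHom_apply, hv]

theorem traceNorm_ofEigen {W : Matrix ι ι ℂ} (hW : W ∈ Matrix.unitaryGroup ι ℂ) (v : ι → ℝ) :
    traceNorm (ofEigen W v) = ∑ i, |v i| := by
  rw [traceNorm, conjTranspose_ofEigen, ofEigen_mul_ofEigen hW, cfc_ofEigen hW, trace_ofEigen hW,
    Complex.ofReal_re]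
  simp [Real.sqrt_mul_self_eq_abs]

theorem vonNeumannEntropy_ofEigen {W : Matrix ι ι ℂ} (hW : W ∈ Matrix.unitaryGroup ι ℂ)
    (v : ι → ℝ) : vonNeumannEntropy (ofEigen W v) = shannonEntropy v := by
  rw [vonNeumannEntropy, cfc_ofEigen hW, ofEigen_mul_ofEigen hW, trace_ofEigen hW,
    Complex.ofReal_re]
  simp [shannonEntropy]

theorem IsState.exists_ofEigen {ρ : Matrix ι ι ℂ} (hρ : IsState ρ) :
    ∃ W ∈ Matrix.unitaryGroup ι ℂ, ∃ p : ι → ℝ, (∀ i, 0 ≤ p i) ∧ ∑ i, p i = 1 ∧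
      ρ = ofEigen W p := by
  obtain ⟨W, hW, h⟩ := hρ.posSemidef.1.exists_ofEigen
  refine ⟨W, hW, _, hρ.posSemidef.eigenvalues_nonneg, ?_, h⟩
  have := hρ.trace_eq_one
  rw [h, trace_ofEigen hW] at this
  exact_mod_cast this

theorem traceNorm_neg (X : Matrix ι ι ℂ) : traceNorm (-X) = traceNorm X := by
  simp [traceNorm]

theorem re_trace_mul_ofEigen (P W : Matrix ι ι ℂ) (v : ι → ℝ) :
    (P * ofEigen W v).trace.re = ∑ i, ((Wᴴ * P * W) i i).re * v i := by
  have h : (P * ofEigen W v).trace = ∑ i, (Wᴴ * P * W) i i * (v i : ℂ) := by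
    rw [ofEigen, ← Matrix.mul_assoc, Matrix.trace_mul_comm, ← Matrix.mul_assoc,
      ← Matrix.mul_assoc, Matrix.trace]
    simp [Matrix.mul_diagonal]
  simp [h, Complex.re_sum]

theorem Matrix.PosSemidef.re_diag_nonneg {A : Matrix ι ι ℂ} (hA : A.PosSemidef) (i : ι) :
    0 ≤ (A i i).re :=
  (Complex.le_def.1 (hA.diag_nonneg (i := i))).1

theorem Matrix.PosSemidef.re_trace_mul_nonneg {A B : Matrix ι ι ℂ} (hA : A.PosSemidef)
    (hB : B.PosSemidef) : 0 ≤ (A * B).trace.re := by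
  obtain ⟨W, _, h⟩ := hB.1.exists_ofEigen
  rw [h, re_trace_mul_ofEigen]
  exact Finset.sum_nonneg fun i _ => mul_nonneg
    ((hA.conjTranspose_mul_mul_same W).re_diag_nonneg i) (hB.eigenvalues_nonneg i)

/-- In an eigenbasis of `X` the diagonal entries of `P` lie in [0, 1], so each eigenvalue
contributes at most its absolute value. -/
theorem re_trace_mul_le_traceNorm {P X : Matrix ι ι ℂ} (hP : P.PosSemidef)
    (hP1 : (1 - P).PosSemidef) (hX : X.IsHermitian) : (P * X).trace.re ≤ traceNorm X := by
  obtain ⟨W, hW, h⟩ := hX.exists_ofEigen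
  rw [h, traceNorm_ofEigen hW, re_trace_mul_ofEigen]
  refine Finset.sum_le_sum fun i _ => ?_
  have h0 := (hP.conjTranspose_mul_mul_same W).re_diag_nonneg i
  have h1 := (hP1.conjTranspose_mul_mul_same W).re_diag_nonneg i
  have hWW : Wᴴ * W = 1 := Matrix.mem_unitaryGroup_iff'.1 hW
  have h2 : Wᴴ * (1 - P) * W = 1 - Wᴴ * P * W := by
    rw [Matrix.mul_sub, Matrix.sub_mul, Matrix.mul_one, hWW]
  rw [h2, Matrix.sub_apply, Matrix.one_apply_eq, Complex.sub_re, Complex.one_re] at h1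
  refine (le_abs_self _).trans ?_
  rw [abs_mul, abs_of_nonneg h0]
  exact mul_le_of_le_one_left (abs_nonneg _) (by linarith)

/-- Every Hermitian matrix has a support projection. -/
theorem Matrix.IsHermitian.exists_support_projection {A : Matrix ι ι ℂ} (hA : A.IsHermitian) :
    ∃ P : Matrix ι ι ℂ, P.PosSemidef ∧ (1 - P).PosSemidef ∧ P * A = A ∧
      P.trace = (A.rank : ℂ) := by
  obtain ⟨W, hW, h⟩ := hA.exists_ofEigen
  refine ⟨ofEigen W fun i => if hA.eigenvalues i = 0 then 0 else 1, ofEigen_posSemidef _ ?_,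
    ?_, ?_, ?_⟩
  · intro i; split_ifs <;> simp
  · rw [← ofEigen_one hW, ofEigen_sub]
    refine ofEigen_posSemidef _ fun i => ?_
    simp only [Pi.sub_apply]
    split_ifs <;> simp
  · refine (congrArg _ h).trans (Eq.trans ?_ h.symm)
    rw [ofEigen_mul_ofEigen hW]
    congr 1
    ext i
    split_ifs with h0 <;> simp [h0]
  · rw [trace_ofEigen hW, hA.rank_eq_card_non_zero_eigs, Fintype.card_subtype]
    simp [Finset.sum_ite]

end Diagonalization

/-! ### Tensor powers and partial traces -/

section TensorPower

variable {ι : Type*} [Fintype ι] [DecidableEq ι]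

theorem tensorPower_mul (A B : Matrix ι ι ℂ) (n : ℕ) :
    tensorPower (A * B) n = tensorPower A n * tensorPower B n := by
  ext i j
  simp [tensorPower, Matrix.mul_apply, Finset.prod_univ_sum, ← Finset.prod_mul_distrib]

theorem tensorPower_conjTranspose (A : Matrix ι ι ℂ) (n : ℕ) :
    tensorPower Aᴴ n = (tensorPower A n)ᴴ := by
  ext i j
  simp [tensorPower]

theorem tensorPower_diagonal (v : ι → ℂ) (n : ℕ) :
    tensorPower (Matrix.diagonal v) n = Matrix.diagonal fun x => ∏ k, v (x k) := by
  ext i j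
  rcases eq_or_ne i j with rfl | h
  · simp [tensorPower]
  · obtain ⟨k, hk⟩ := Function.ne_iff.1 h
    rw [Matrix.diagonal_apply_ne _ h]
    exact Finset.prod_eq_zero (Finset.mem_univ k) (Matrix.diagonal_apply_ne _ hk)

theorem tensorPower_one (n : ℕ) : tensorPower (1 : Matrix ι ι ℂ) n = 1 := by
  rw [← Matrix.diagonal_one, tensorPower_diagonal]
  simp

theorem tensorPower_mem_unitaryGroup {W : Matrix ι ι ℂ} (hW : W ∈ Matrix.unitaryGroup ι ℂ)
    (n : ℕ) : tensorPower W n ∈ Matrix.unitaryGroup (Fin n → ι) ℂ := by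
  rw [Matrix.mem_unitaryGroup_iff, Matrix.star_eq_conjTranspose, ← tensorPower_conjTranspose,
    ← tensorPower_mul, ← Matrix.star_eq_conjTranspose, Matrix.mem_unitaryGroup_iff.1 hW,
    tensorPower_one]

theorem tensorPower_ofEigen (W : Matrix ι ι ℂ) (v : ι → ℝ) (n : ℕ) :
    tensorPower (ofEigen W v) n = ofEigen (tensorPower W n) fun x => ∏ k, v (x k) := by
  rw [ofEigen, tensorPower_mul, tensorPower_mul, tensorPower_diagonal, tensorPower_conjTranspose,
    ofEigen]
  simp

end TensorPower

section PartialTrace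

variable {ι κ : Type*} [Fintype ι] [DecidableEq ι] [Fintype κ] [DecidableEq κ]

theorem ofEigen_kronecker (W : Matrix ι ι ℂ) (V : Matrix κ κ ℂ) (v : ι → ℝ) (w : κ → ℝ) :
    ofEigen W v ⊗ₖ ofEigen V w = ofEigen (W ⊗ₖ V) fun x => v x.1 * w x.2 := by
  simp only [ofEigen, Matrix.mul_kronecker_mul, Matrix.conjTranspose_kronecker,
    Matrix.diagonal_kronecker_diagonal, Complex.ofReal_mul]

theorem mul_ofEigen_mul_conjTranspose (U W : Matrix ι ι ℂ) (v : ι → ℝ) :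
    U * ofEigen W v * Uᴴ = ofEigen (U * W) v := by
  simp [ofEigen, Matrix.conjTranspose_mul, Matrix.mul_assoc]

theorem traceAnc_sub (X Y : Matrix (ι × κ) (ι × κ) ℂ) :
    traceAnc (X - Y) = traceAnc X - traceAnc Y := by
  ext i j; simp [traceAnc]

theorem traceAnc_add (X Y : Matrix (ι × κ) (ι × κ) ℂ) :
    traceAnc (X + Y) = traceAnc X + traceAnc Y := by
  ext i j; simp [traceAnc, Finset.sum_add_distrib]

theorem traceAnc_kronecker (A : Matrix ι ι ℂ) (B : Matrix κ κ ℂ) :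
    traceAnc (A ⊗ₖ B) = B.trace • A := by
  ext i j
  simp [traceAnc, Matrix.trace, ← Finset.mul_sum, mul_comm]

theorem trace_traceAnc (X : Matrix (ι × κ) (ι × κ) ℂ) : (traceAnc X).trace = X.trace := by
  simp [traceAnc, Matrix.trace, Fintype.sum_prod_type]

theorem traceAnc_kronecker_one_mul (A : Matrix ι ι ℂ) (X : Matrix (ι × κ) (ι × κ) ℂ) :
    traceAnc ((A ⊗ₖ (1 : Matrix κ κ ℂ)) * X) = A * traceAnc X := by
  ext i j
  simp only [traceAnc, Matrix.of_apply, Matrix.mul_apply, Fintype.sum_prod_type,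
    Matrix.kronecker_apply, Finset.mul_sum]
  rw [Finset.sum_comm]
  simp [Matrix.one_apply]

theorem traceAnc_conjTranspose (X : Matrix (ι × κ) (ι × κ) ℂ) :
    traceAnc Xᴴ = (traceAnc X)ᴴ := by
  ext i j
  simp [traceAnc]

theorem traceAnc_mul_kronecker_one (A : Matrix ι ι ℂ) (X : Matrix (ι × κ) (ι × κ) ℂ) :
    traceAnc (X * (A ⊗ₖ (1 : Matrix κ κ ℂ))) = traceAnc X * A := by
  have h := traceAnc_kronecker_one_mul (κ := κ) Aᴴ Xᴴ
  rw [traceAnc_conjTranspose, ← Matrix.conjTranspose_mul] at h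
  rw [← Matrix.conjTranspose_inj, ← h, ← traceAnc_conjTranspose, Matrix.conjTranspose_mul,
    Matrix.conjTranspose_kronecker, Matrix.conjTranspose_one]

theorem traceAnc_eq_sum_submatrix (X : Matrix (ι × κ) (ι × κ) ℂ) :
    traceAnc X = ∑ a, X.submatrix (fun i => (i, a)) fun i => (i, a) := by
  ext i j
  simp [traceAnc, Matrix.sum_apply]

theorem Matrix.PosSemidef.traceAnc {X : Matrix (ι × κ) (ι × κ) ℂ} (hX : X.PosSemidef) :
    (traceAnc X).PosSemidef := by
  rw [traceAnc_eq_sum_submatrix]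
  exact Matrix.posSemidef_sum _ fun a _ => hX.submatrix _

theorem Matrix.rank_add_le_add (A B : Matrix ι ι ℂ) : (A + B).rank ≤ A.rank + B.rank := by
  simp only [Matrix.rank]
  refine (Submodule.finrank_mono (t := LinearMap.range A.mulVecLin ⊔ LinearMap.range B.mulVecLin)
    ?_).trans (Submodule.finrank_add_le_finrank_add_finrank _ _)
  rintro _ ⟨x, rfl⟩
  rw [Matrix.mulVecLin_add]
  exact Submodule.add_mem_sup (LinearMap.mem_range_self _ x) (LinearMap.mem_range_self _ x)

theorem Matrix.rank_sum_le {α : Type*} (s : Finset α) (f : α → Matrix ι ι ℂ) :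
    (∑ a ∈ s, f a).rank ≤ ∑ a ∈ s, (f a).rank := by
  classical
  induction s using Finset.induction_on with
  | empty => simp
  | insert a s ha ih =>
    rw [Finset.sum_insert ha, Finset.sum_insert ha]
    exact (Matrix.rank_add_le_add _ _).trans (Nat.add_le_add_left ih _)

/-- The partial trace is a sum of `card κ` diagonal blocks, and passing to a block cannot raise the
rank. -/
theorem rank_traceAnc_le (X : Matrix (ι × κ) (ι × κ) ℂ) :
    (traceAnc X).rank ≤ Fintype.card κ * X.rank := by
  rw [traceAnc_eq_sum_submatrix]
  refine (Matrix.rank_sum_le _ _).trans ?_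
  refine (Finset.sum_le_card_nsmul _ _ X.rank fun a _ => ?_).trans_eq (by simp)
  exact Matrix.rank_submatrix_le X _ _

theorem rank_ofEigen_le (W : Matrix ι ι ℂ) (v : ι → ℝ) :
    (ofEigen W v).rank ≤ (Finset.univ.filter fun i => v i ≠ 0).card := by
  refine ((Matrix.rank_mul_le_left _ _).trans (Matrix.rank_mul_le_right _ _)).trans ?_
  rw [Matrix.rank_diagonal, Fintype.card_subtype]
  simp

end PartialTrace

/-! ### Distinguishing states of small support from flat states -/

/-- The test is the support projection of the reduced typical part of the first state. It captures
mass at least `1 - ε` there. On the second state it sees at most `ε` from the atypical part, plus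
its rank times the operator bound `u * card κ` on the reduced typical part. -/
theorem le_traceNorm_traceAnc_sub {X κ : Type*} [Fintype X] [DecidableEq X] [Fintype κ]
    [DecidableEq κ] {P Q : X → ℝ} {e f : κ → ℝ} (hP0 : ∀ x, 0 ≤ P x) (hQ0 : ∀ x, 0 ≤ Q x)
    (hP : ∑ x, P x = 1) (he0 : ∀ k, 0 ≤ e k) (hf0 : ∀ k, 0 ≤ f k)
    (he : ∑ k, e k = 1) (hf : ∑ k, f k = 1) {Y Z : Matrix (X × κ) (X × κ) ℂ}
    (hY : Y ∈ Matrix.unitaryGroup (X × κ) ℂ) (hZ : Z ∈ Matrix.unitaryGroup (X × κ) ℂ)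
    {TP TQ : Finset X} {u ε : ℝ} (hu : 0 ≤ u) (hTQ : ∀ x ∈ TQ, Q x ≤ u)
    (hεP : ∑ x ∈ TPᶜ, P x ≤ ε) (hεQ : ∑ x ∈ TQᶜ, Q x ≤ ε) :
    1 - 2 * ε - u * Fintype.card κ ^ 3 * TP.card ≤
      traceNorm (traceAnc (ofEigen Y (fun y => P y.1 * e y.2) -
        ofEigen Z (fun y => Q y.1 * f y.2))) := by
  have split (T : Finset X) (R : X → ℝ) (g : κ → ℝ) (W : Matrix (X × κ) (X × κ) ℂ) :
      ofEigen W (fun y => R y.1 * g y.2) =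
        ofEigen W (fun y => (if y.1 ∈ T then R y.1 else 0) * g y.2) +
          ofEigen W (fun y => (if y.1 ∈ T then 0 else R y.1) * g y.2) := by
    rw [ofEigen_add]
    congr 1
    ext y
    simp only [Pi.add_apply]
    split_ifs <;> simp
  have trace_eq {W : Matrix (X × κ) (X × κ) ℂ} (hW : W ∈ Matrix.unitaryGroup (X × κ) ℂ)
      (R : X → ℝ) {g : κ → ℝ} (hg : ∑ k, g k = 1) :
      (traceAnc (ofEigen W (fun y => R y.1 * g y.2))).trace.re = ∑ x, R x := by
    rw [trace_traceAnc, trace_ofEigen hW, Complex.ofReal_re, Fintype.sum_prod_type]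
    simp [← Finset.mul_sum, hg]
  have herm : (traceAnc (ofEigen Y (fun y => P y.1 * e y.2) -
        ofEigen Z (fun y => Q y.1 * f y.2))).IsHermitian := by
    rw [Matrix.IsHermitian, ← traceAnc_conjTranspose, Matrix.conjTranspose_sub,
      conjTranspose_ofEigen, conjTranspose_ofEigen]
  rw [split TP P e Y, split TQ Q f Z] at herm ⊢
  set A₁ := ofEigen Y (fun y => (if y.1 ∈ TP then P y.1 else 0) * e y.2)
  set A₂ := ofEigen Y (fun y => (if y.1 ∈ TP then 0 else P y.1) * e y.2)
  set B₁ := ofEigen Z (fun y => (if y.1 ∈ TQ then Q y.1 else 0) * f y.2) with hB₁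
  set B₂ := ofEigen Z (fun y => (if y.1 ∈ TQ then 0 else Q y.1) * f y.2)
  have hA₁ : (traceAnc A₁).PosSemidef := (ofEigen_posSemidef _ fun y =>
    mul_nonneg (by split_ifs; exacts [hP0 _, le_rfl]) (he0 _)).traceAnc
  have hA₂ : (traceAnc A₂).PosSemidef := (ofEigen_posSemidef _ fun y =>
    mul_nonneg (by split_ifs; exacts [le_rfl, hP0 _]) (he0 _)).traceAnc
  have hB₂ : (traceAnc B₂).PosSemidef := (ofEigen_posSemidef _ fun y =>
    mul_nonneg (by split_ifs; exacts [le_rfl, hQ0 _]) (hf0 _)).traceAnc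
  obtain ⟨E, hE0, hE1, hEA, hEtr⟩ := hA₁.1.exists_support_projection
  refine le_trans ?_ (re_trace_mul_le_traceNorm hE0 hE1 herm)
  have hA₁tr : 1 - ε ≤ (E * traceAnc A₁).trace.re := by
    rw [hEA, trace_eq hY (fun x => if x ∈ TP then P x else 0) he]
    have := Finset.sum_add_sum_compl TP P
    simp only [Finset.sum_ite_mem, Finset.univ_inter]
    linarith
  have hA₂tr : 0 ≤ (E * traceAnc A₂).trace.re := hE0.re_trace_mul_nonneg hA₂
  have hB₂tr : (E * traceAnc B₂).trace.re ≤ ε := by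
    have h1 := hE1.re_trace_mul_nonneg hB₂
    rw [Matrix.sub_mul, Matrix.one_mul, Matrix.trace_sub, Complex.sub_re,
      trace_eq hZ (fun x => if x ∈ TQ then 0 else Q x) hf] at h1
    have h2 : ∑ x, (if x ∈ TQ then 0 else Q x) = ∑ x ∈ TQᶜ, Q x := by
      rw [← Finset.sum_add_sum_compl TQ, Finset.sum_eq_zero (s := TQ) (by simp +contextual),
        zero_add]
      exact Finset.sum_congr rfl fun x hx => if_neg (Finset.mem_compl.1 hx)
    linarith
  -- One factor `card κ` comes from the rank of the ancilla state, the other from the partial trace.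
  have hrank : ((traceAnc A₁).rank : ℝ) ≤ Fintype.card κ ^ 2 * TP.card := by
    have h1 : A₁.rank ≤ TP.card * Fintype.card κ := by
      refine (rank_ofEigen_le _ _).trans ?_
      rw [← Finset.card_univ, ← Finset.card_product]
      refine Finset.card_le_card fun y hy => ?_
      simp only [Finset.mem_filter, Finset.mem_univ, true_and] at hy
      simp only [Finset.mem_product, Finset.mem_univ, and_true]
      by_contra h
      simp [h] at hy
    have h2 := (rank_traceAnc_le A₁).trans (Nat.mul_le_mul_left _ h1)
    calc ((traceAnc A₁).rank : ℝ) ≤ (Fintype.card κ * (TP.card * Fintype.card κ) : ℕ) := by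
          exact_mod_cast h2
      _ = _ := by push_cast; ring
  -- Before the partial trace `B₁` is at most `u` times the identity; tracing out the ancilla
  -- multiplies this bound by `card κ`.
  have hB₁tr : (E * traceAnc B₁).trace.re ≤ u * Fintype.card κ ^ 3 * TP.card := by
    have h1 : (traceAnc (ofEigen Z (fun _ => u) - B₁)).PosSemidef := by
      rw [hB₁, ofEigen_sub]
      refine (ofEigen_posSemidef _ fun y => ?_).traceAnc
      have hf1 : f y.2 ≤ 1 := hf ▸ Finset.single_le_sum (fun k _ => hf0 k) (Finset.mem_univ y.2)
      simp only [Pi.sub_apply, sub_nonneg]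
      split_ifs with h
      · exact (mul_le_of_le_one_right (hQ0 _) hf1).trans (hTQ _ h)
      · simpa using hu
    have h2 : traceAnc (ofEigen Z (fun _ => u)) =
        ((u * Fintype.card κ : ℝ) : ℂ) • (1 : Matrix X X ℂ) := by
      have h : ofEigen Z (fun _ => u) = ((u : ℂ) • (1 : Matrix X X ℂ)) ⊗ₖ (1 : Matrix κ κ ℂ) := by
        have := (ofEigenAlgHom hZ).commutes u
        rw [Matrix.smul_kronecker, Matrix.one_kronecker_one]
        refine this.trans ?_
        rw [Algebra.algebraMap_eq_smul_one, Complex.coe_smul]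
      rw [h, traceAnc_kronecker, Matrix.trace_one, smul_smul]
      push_cast
      rw [mul_comm]
    have h3 := hE0.re_trace_mul_nonneg h1
    rw [traceAnc_sub, h2, Matrix.mul_sub, Matrix.trace_sub, Matrix.mul_smul, Matrix.mul_one,
      Matrix.trace_smul, hEtr, smul_eq_mul, Complex.sub_re, Complex.re_ofReal_mul,
      Complex.natCast_re] at h3
    calc _ ≤ u * Fintype.card κ * (traceAnc A₁).rank := by linarith
      _ ≤ u * Fintype.card κ * (Fintype.card κ ^ 2 * TP.card) := by gcongr
      _ = _ := by ring
  rw [traceAnc_sub, traceAnc_add, traceAnc_add, Matrix.mul_sub, Matrix.mul_add, Matrix.mul_add,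
    Matrix.trace_sub, Matrix.trace_add, Matrix.trace_add, Complex.sub_re, Complex.add_re,
    Complex.add_re]
  linarith

/-! ### Transforming one state into another by permuting eigenvectors -/

theorem one_submatrix_mem_unitaryGroup {α : Type*} [Fintype α] [DecidableEq α] (g : α ≃ α) :
    (1 : Matrix α α ℂ).submatrix g id ∈ Matrix.unitaryGroup α ℂ := by
  rw [Matrix.mem_unitaryGroup_iff, Matrix.star_eq_conjTranspose]
  ext i j
  simp [Matrix.mul_apply, Matrix.one_apply]

theorem one_submatrix_mul_ofEigen {α : Type*} [Fintype α] [DecidableEq α] (g : α ≃ α)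
    (a : α → ℝ) : ofEigen ((1 : Matrix α α ℂ).submatrix g id) a = ofEigen 1 (a ∘ g) := by
  ext i j
  simp [ofEigen, Matrix.mul_apply, Matrix.one_apply, Matrix.diagonal_apply]
  split_ifs with h
  · rw [h]
  · rfl

theorem traceAnc_ofEigen_kronecker_one {ι κ : Type*} [Fintype ι] [DecidableEq ι] [Fintype κ]
    [DecidableEq κ] (W : Matrix ι ι ℂ) (b : ι × κ → ℝ) :
    traceAnc (ofEigen (W ⊗ₖ (1 : Matrix κ κ ℂ)) b) = ofEigen W fun x => ∑ k, b (x, k) := by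
  rw [ofEigen, Matrix.conjTranspose_kronecker, Matrix.conjTranspose_one,
    traceAnc_mul_kronecker_one, traceAnc_kronecker_one_mul, ofEigen]
  congr 2
  ext i j
  rcases eq_or_ne i j with rfl | h
  · simp [traceAnc]
  · simp [traceAnc, Matrix.diagonal_apply, h]

theorem kronecker_one_mem_unitaryGroup {ι : Type*} (κ : Type*) [Fintype ι] [DecidableEq ι]
    [Fintype κ] [DecidableEq κ] {W : Matrix ι ι ℂ} (hW : W ∈ Matrix.unitaryGroup ι ℂ) :
    W ⊗ₖ (1 : Matrix κ κ ℂ) ∈ Matrix.unitaryGroup (ι × κ) ℂ :=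
  Matrix.kronecker_mem_unitary hW (one_mem _)

/-- The unitary undoes the eigenbasis `W`, permutes the joint basis by `g`, and applies `V`. The
reduced state is then diagonal in the same basis as the target, so the trace norm is an ℓ¹ distance.
-/
theorem exists_unitary_traceNorm_eq {X κ : Type*} [Fintype X] [DecidableEq X] [Fintype κ]
    [DecidableEq κ] {W V : Matrix X X ℂ} (hW : W ∈ Matrix.unitaryGroup X ℂ)
    (hV : V ∈ Matrix.unitaryGroup X ℂ) (P Q : X → ℝ) (w : κ → ℝ) (g : X × κ ≃ X × κ) :
    ∃ U ∈ Matrix.unitaryGroup (X × κ) ℂ,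
      traceNorm (traceAnc (U * (ofEigen W P ⊗ₖ ofEigen 1 w) * Uᴴ) - ofEigen V Q) =
        ∑ x, |∑ k, P (g (x, k)).1 * w (g (x, k)).2 - Q x| := by
  have hW' := kronecker_one_mem_unitaryGroup κ hW
  have hV' := kronecker_one_mem_unitaryGroup κ hV
  refine ⟨(V ⊗ₖ 1) * ((1 : Matrix (X × κ) (X × κ) ℂ).submatrix g id * star (W ⊗ₖ 1)),
    mul_mem hV' (mul_mem (one_submatrix_mem_unitaryGroup g) (Unitary.star_mem hW')), ?_⟩
  rw [ofEigen_kronecker, mul_ofEigen_mul_conjTranspose, Matrix.mul_assoc, Matrix.mul_assoc,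
    Matrix.mem_unitaryGroup_iff'.1 hW', Matrix.mul_one, ← mul_ofEigen_mul_conjTranspose,
    one_submatrix_mul_ofEigen, mul_ofEigen_mul_conjTranspose, Matrix.mul_one,
    traceAnc_ofEigen_kronecker_one, ofEigen_sub, traceNorm_ofEigen hV]
  rfl

/-! ### Asymptotics -/

/-- The width `√(n log₂ n)` of the typical window. -/
noncomputable def typicalWidth (n : ℕ) : ℝ := Real.sqrt (n * Real.logb 2 n)

theorem typicalWidth_nonneg (n : ℕ) : 0 ≤ typicalWidth n := Real.sqrt_nonneg _

theorem tendsto_logb_two_natCast : Tendsto (fun n : ℕ => Real.logb 2 n) atTop atTop :=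
  (Real.tendsto_logb_atTop (by norm_num)).comp tendsto_natCast_atTop_atTop

theorem logb_two_natCast_nonneg (n : ℕ) : 0 ≤ Real.logb 2 (n : ℝ) := by
  rcases n.eq_zero_or_pos with rfl | h
  · simp
  · exact Real.logb_nonneg (by norm_num) (by exact_mod_cast h)

theorem tendsto_typicalWidth : Tendsto typicalWidth atTop atTop :=
  Real.tendsto_sqrt_atTop.comp (tendsto_natCast_atTop_atTop.atTop_mul_atTop₀
    tendsto_logb_two_natCast)

theorem isLittleO_typicalWidth : typicalWidth =o[atTop] fun n : ℕ => (n : ℝ) := by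
  have h1 : (fun n : ℕ => Real.logb 2 n) =o[atTop] fun n : ℕ => (n : ℝ) := by
    have := (Real.isLittleO_log_id_atTop.comp_tendsto tendsto_natCast_atTop_atTop).const_mul_left
      (Real.log 2)⁻¹
    refine this.congr_left fun n => ?_
    simp [Real.logb, div_eq_inv_mul]
  have h2 : (fun n : ℕ => (n : ℝ) * Real.logb 2 n) =o[atTop] fun n : ℕ => (n : ℝ) * n :=
    (isBigO_refl _ _).mul_isLittleO h1
  refine IsLittleO.of_pow (n := 2) (h2.congr (fun n => ?_) fun n => ?_) two_ne_zero
  · rw [Pi.pow_apply, typicalWidth,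
      Real.sq_sqrt (mul_nonneg n.cast_nonneg (logb_two_natCast_nonneg n))]
  · rw [Pi.pow_apply, sq]

theorem eventually_sum_notMem_typicalSet_le {ι : Type*} [Fintype ι] [DecidableEq ι] {p : ι → ℝ}
    (hp0 : ∀ i, 0 ≤ p i) (hp : ∑ i, p i = 1) : ∀ᶠ n : ℕ in atTop,
      ∑ x ∈ (typicalSet p n (typicalWidth n))ᶜ, ∏ k, p (x k) ≤ varentropy p / Real.logb 2 n := by
  filter_upwards [eventually_ge_atTop 2] with n hn
  have hn0 : (0 : ℝ) < n := by positivity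
  have hlog : 0 < Real.logb 2 (n : ℝ) := Real.logb_pos (by norm_num) (by exact_mod_cast hn)
  refine (sum_notMem_typicalSet_le hp0 hp n (Real.sqrt_pos.2 (mul_pos hn0 hlog))).trans_eq ?_
  rw [Real.sq_sqrt (mul_pos hn0 hlog).le, mul_div_mul_left _ _ hn0.ne']

theorem IsState.dim_pos {D : ℕ} {η : Matrix (Fin D) (Fin D) ℂ} (hη : IsState η) :
    0 < D := by
  rcases D.eq_zero_or_pos with rfl | h
  · simpa using hη.trace_eq_one
  · exact h

theorem two_rpow_systemSize {D : ℕ} (hD : 0 < D) : (2 : ℝ) ^ systemSize D = D :=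
  Real.rpow_logb (by norm_num) (by norm_num) (by exact_mod_cast hD)

/-- If the inequality failed, the lower bound from `le_traceNorm_traceAnc_sub` would tend to 1 while
the trace norm tends to 0. -/
theorem vonNeumannEntropy_le_of_tendsto {d : ℕ} {ρ σ : Matrix (Fin d) (Fin d) ℂ} (hρ : IsState ρ)
    (hσ : IsState σ) {D : ℕ → ℕ} {η ν : ∀ n, Matrix (Fin (D n)) (Fin (D n)) ℂ}
    {U V : ∀ n, Matrix ((Fin n → Fin d) × Fin (D n)) ((Fin n → Fin d) × Fin (D n)) ℂ}
    (hD : (fun n => systemSize (D n)) =o[atTop] (fun n : ℕ => (n : ℝ)))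
    (hη : ∀ n, IsState (η n)) (hν : ∀ n, IsState (ν n))
    (hU : ∀ n, U n ∈ Matrix.unitaryGroup ((Fin n → Fin d) × Fin (D n)) ℂ)
    (hV : ∀ n, V n ∈ Matrix.unitaryGroup ((Fin n → Fin d) × Fin (D n)) ℂ)
    (h : Tendsto (fun n => traceNorm
      (traceAnc (U n * (tensorPower ρ n ⊗ₖ η n) * (U n)ᴴ -
        V n * (tensorPower σ n ⊗ₖ ν n) * (V n)ᴴ))) atTop (𝓝 0)) :
    vonNeumannEntropy σ ≤ vonNeumannEntropy ρ := by
  obtain ⟨W, hW, p, hp0, hp, rfl⟩ := hρ.exists_ofEigen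
  obtain ⟨W', hW', q, hq0, hq, rfl⟩ := hσ.exists_ofEigen
  rw [vonNeumannEntropy_ofEigen hW, vonNeumannEntropy_ofEigen hW']
  by_contra! hlt
  set δ := shannonEntropy q - shannonEntropy p with hδ
  have hδ0 : 0 < δ := sub_pos.2 hlt
  set v := max (varentropy p) (varentropy q)
  have hbound : ∀ᶠ n : ℕ in atTop, 1 - 2 * (v / Real.logb 2 n) -
      2 ^ (-(n : ℝ) * (δ - (2 * typicalWidth n + 3 * systemSize (D n)) / n)) ≤
      traceNorm (traceAnc (U n * (tensorPower (ofEigen W p) n ⊗ₖ η n) * (U n)ᴴ -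
        V n * (tensorPower (ofEigen W' q) n ⊗ₖ ν n) * (V n)ᴴ)) := by
    filter_upwards [eventually_sum_notMem_typicalSet_le hp0 hp,
      eventually_sum_notMem_typicalSet_le hq0 hq, eventually_ge_atTop 1] with n h1 h2 hn
    obtain ⟨E, hE, e, he0, he, hηE⟩ := (hη n).exists_ofEigen
    obtain ⟨F, hF, f, hf0, hf, hνF⟩ := (hν n).exists_ofEigen
    rw [hηE, hνF, tensorPower_ofEigen, tensorPower_ofEigen, ofEigen_kronecker, ofEigen_kronecker,
      mul_ofEigen_mul_conjTranspose, mul_ofEigen_mul_conjTranspose]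
    have hv (r : Fin d → ℝ) (hr : varentropy r ≤ v) :
        varentropy r / Real.logb 2 (n : ℝ) ≤ v / Real.logb 2 n :=
      div_le_div_of_nonneg_right hr (logb_two_natCast_nonneg n)
    have key := le_traceNorm_traceAnc_sub (P := fun x : Fin n → Fin d => ∏ k, p (x k))
      (Q := fun x : Fin n → Fin d => ∏ k, q (x k)) (e := e) (f := f)
      (TP := typicalSet p n (typicalWidth n)) (TQ := typicalSet q n (typicalWidth n))
      (fun x => Finset.prod_nonneg fun k _ => hp0 _) (fun x => Finset.prod_nonneg fun k _ => hq0 _)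
      (sum_prod_eq_one hp n) he0 hf0 he hf
      (mul_mem (hU n) (Matrix.kronecker_mem_unitary (tensorPower_mem_unitaryGroup hW n) hE))
      (mul_mem (hV n) (Matrix.kronecker_mem_unitary (tensorPower_mem_unitaryGroup hW' n) hF))
      (u := 2 ^ (-(n * shannonEntropy q) + typicalWidth n)) (by positivity)
      (fun x hx => (Finset.mem_filter.1 hx).2.2)
      (h1.trans (hv _ (le_max_left _ _))) (h2.trans (hv _ (le_max_right _ _)))
    refine le_trans (sub_le_sub_left ?_ _) key
    rw [Fintype.card_fin, ← two_rpow_systemSize (hη n).dim_pos]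
    refine (mul_le_mul_of_nonneg_left (card_typicalSet_le hp0 hp n _) (by positivity)).trans_eq ?_
    rw [← Real.rpow_mul_natCast (by norm_num), ← Real.rpow_add (by norm_num),
      ← Real.rpow_add (by norm_num)]
    congr 1
    have : (n : ℝ) ≠ 0 := by positivity
    rw [hδ]
    field_simp
    push_cast
    ring
  have hlim : Tendsto (fun n : ℕ => 1 - 2 * (v / Real.logb 2 n) -
      (2 : ℝ) ^ (-(n : ℝ) * (δ - (2 * typicalWidth n + 3 * systemSize (D n)) / n))) atTop
      (𝓝 (1 - 2 * 0 - 0)) := by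
    refine (tendsto_const_nhds.sub
      ((tendsto_const_nhds.div_atTop tendsto_logb_two_natCast).const_mul 2)).sub ?_
    refine (tendsto_rpow_atBot_of_base_gt_one 2 (by norm_num)).comp ?_
    have h0 : Tendsto (fun n : ℕ => (2 * typicalWidth n + 3 * systemSize (D n)) / n) atTop (𝓝 0) :=
      ((isLittleO_typicalWidth.const_mul_left 2).add (hD.const_mul_left 3)).tendsto_div_nhds_zero
    have h1 := tendsto_const_nhds (x := δ).sub h0
    rw [sub_zero] at h1
    exact Tendsto.atBot_mul_pos hδ0
      (tendsto_neg_atTop_atBot.comp tendsto_natCast_atTop_atTop) h1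
  have := le_of_tendsto_of_tendsto hlim h hbound
  norm_num at this

theorem exists_catalyst_of_entropy_eq {d : ℕ} {ρ σ : Matrix (Fin d) (Fin d) ℂ} (hρ : IsState ρ)
    (hσ : IsState σ) (h : vonNeumannEntropy ρ = vonNeumannEntropy σ) :
    ∃ (D : ℕ → ℕ) (η : ∀ n, Matrix (Fin (D n)) (Fin (D n)) ℂ)
      (U : ∀ n, Matrix ((Fin n → Fin d) × Fin (D n)) ((Fin n → Fin d) × Fin (D n)) ℂ),
      (fun n => systemSize (D n)) =O[atTop] (fun n : ℕ => Real.sqrt (n * Real.logb 2 n)) ∧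
      (∀ n, IsState (η n)) ∧
      (∀ n, U n ∈ Matrix.unitaryGroup ((Fin n → Fin d) × Fin (D n)) ℂ) ∧
      Tendsto (fun n => traceNorm
        (traceAnc (U n * (tensorPower ρ n ⊗ₖ η n) * (U n)ᴴ) - tensorPower σ n)) atTop (𝓝 0) := by
  obtain ⟨W, hW, p, hp0, hp, rfl⟩ := hρ.exists_ofEigen
  obtain ⟨V, hV, q, hq0, hq, rfl⟩ := hσ.exists_ofEigen
  rw [vonNeumannEntropy_ofEigen hW, vonNeumannEntropy_ofEigen hV] at h
  set S := shannonEntropy p with hS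
  set v := max (varentropy p) (varentropy q)
  -- Two demands on m: the bin capacity K·2^(2w) ≤ K² needs m ≥ 2w, and the packing error 2^(2w - m)
  -- ≤ 2^(-w) needs m ≥ 3w.
  set m : ℕ → ℕ := fun n => ⌈3 * typicalWidth n⌉₊ with hm
  have hm3 (n) : 3 * typicalWidth n ≤ m n := Nat.le_ceil _
  set K : ℕ → ℕ := fun n => 2 ^ m n with hK
  have hKpos (n) : 0 < K n := by positivity
  have hKD (n) : K n ≤ K n * K n := Nat.le_mul_of_pos_left _ (hKpos n)
  have hKr (n) : (K n : ℝ) = 2 ^ (m n : ℝ) := by simp [hK]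
  have hgood (n : ℕ) : ∃ g : (Fin n → Fin d) × Fin (K n * K n) ≃ (Fin n → Fin d) × Fin (K n * K n),
      (∑ x ∈ (typicalSet p n (typicalWidth n))ᶜ, ∏ k, p (x k) ≤ v / Real.logb 2 n →
       ∑ x ∈ (typicalSet q n (typicalWidth n))ᶜ, ∏ k, q (x k) ≤ v / Real.logb 2 n →
        ∑ x, |∑ k, (∏ i, p ((g (x, k)).1 i)) * uniformWeight (K n) (K n * K n) (g (x, k)).2 -
          ∏ i, q (x i)| ≤ 2 * (v / Real.logb 2 n + 2 ^ (-typicalWidth n))) := by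
    by_cases hcond : ∑ x ∈ (typicalSet p n (typicalWidth n))ᶜ, ∏ k, p (x k) ≤ v / Real.logb 2 n ∧
       ∑ x ∈ (typicalSet q n (typicalWidth n))ᶜ, ∏ k, q (x k) ≤ v / Real.logb 2 n
    · obtain ⟨g, hg⟩ := exists_perm_redistribute
        (fun x => Finset.prod_nonneg fun k _ => hp0 _) (fun x => Finset.prod_nonneg fun k _ => hq0 _)
        (sum_prod_eq_one hp n) (sum_prod_eq_one hq n)
        (l := 2 ^ (-(n * S) - typicalWidth n)) (u := 2 ^ (-(n * S) + typicalWidth n))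
        (by positivity) (by positivity)
        (fun x hx => (Finset.mem_filter.1 hx).2)
        (fun x hx => by rw [h]; exact (Finset.mem_filter.1 hx).2)
        hcond.1 hcond.2 (hKpos n) (hKD n) (by
          push_cast
          rw [hKr, ← Real.rpow_add (by norm_num), ← Real.rpow_add (by norm_num),
            ← Real.rpow_add (by norm_num)]
          refine Real.rpow_le_rpow_of_exponent_le (by norm_num) ?_
          linarith [hm3 n, typicalWidth_nonneg n])
      refine ⟨g, fun _ _ => hg.trans ?_⟩
      gcongr
      rw [hKr, ← Real.rpow_sub (by norm_num), ← Real.rpow_sub (by norm_num)]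
      refine Real.rpow_le_rpow_of_exponent_le (by norm_num) ?_
      linarith [hm3 n, typicalWidth_nonneg n]
    -- A permutation is needed for every n, but the Chebyshev bounds are only available eventually;
    -- elsewhere any choice will do.
    · exact ⟨Equiv.refl _, fun h1 h2 => absurd ⟨h1, h2⟩ hcond⟩
  choose g hg using hgood
  choose U hU hUn using fun n => exists_unitary_traceNorm_eq
    (tensorPower_mem_unitaryGroup hW n) (tensorPower_mem_unitaryGroup hV n)
    (fun x => ∏ k, p (x k)) (fun x => ∏ k, q (x k)) (uniformWeight (K n) (K n * K n)) (g n)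
  refine ⟨fun n => K n * K n, fun n => ofEigen 1 (uniformWeight (K n) (K n * K n)), U, ?_,
    fun n => ⟨ofEigen_posSemidef _ (uniformWeight_nonneg _ _), ?_⟩, hU, ?_⟩
  · have hsize (n) : systemSize (K n * K n) = 2 * m n := by
      rw [systemSize]
      push_cast
      rw [hKr, ← Real.rpow_add (by norm_num), Real.logb_rpow (by norm_num) (by norm_num)]
      ring
    -- The size is 2m ≤ 2(3w + 1) ≤ 8w once w ≥ 1.
    refine IsBigO.of_bound 8 ?_
    filter_upwards [tendsto_typicalWidth.eventually_ge_atTop 1] with n hn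
    have h1 := (Nat.ceil_lt_add_one (a := 3 * typicalWidth n) (by linarith)).le
    rw [hsize, Real.norm_of_nonneg (by positivity), Real.norm_of_nonneg (Real.sqrt_nonneg _)]
    change _ ≤ 8 * typicalWidth n
    simp only [hm]
    linarith
  · rw [trace_ofEigen (one_mem _), sum_uniformWeight (hKpos n) (hKD n), Complex.ofReal_one]
  · have hlim : Tendsto (fun n : ℕ => 2 * (v / Real.logb 2 n + (2 : ℝ) ^ (-typicalWidth n))) atTop
        (𝓝 (2 * (0 + 0))) :=
      ((tendsto_const_nhds.div_atTop tendsto_logb_two_natCast).add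
        ((tendsto_rpow_atBot_of_base_gt_one 2 (by norm_num)).comp
          (tendsto_neg_atTop_atBot.comp tendsto_typicalWidth))).const_mul 2
    rw [add_zero, mul_zero] at hlim
    have hv (n : ℕ) (r : Fin d → ℝ) (hr : varentropy r ≤ v) :
        varentropy r / Real.logb 2 (n : ℝ) ≤ v / Real.logb 2 n :=
      div_le_div_of_nonneg_right hr (logb_two_natCast_nonneg n)
    simp only [tensorPower_ofEigen, hUn]
    refine tendsto_of_tendsto_of_tendsto_of_le_of_le' tendsto_const_nhds hlim
      (Eventually.of_forall fun n => Finset.sum_nonneg fun x _ => abs_nonneg _) ?_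
    filter_upwards [eventually_sum_notMem_typicalSet_le hp0 hp,
      eventually_sum_notMem_typicalSet_le hq0 hq] with n h1 h2
    exact hg n (h1.trans (hv n _ (le_max_left _ _))) (h2.trans (hv n _ (le_max_right _ _)))

theorem mainTheorem2 (d : ℕ) (ρ σ : Matrix (Fin d) (Fin d) ℂ) (hρ : IsState ρ) (hσ : IsState σ) :
    List.TFAE [
      vonNeumannEntropy ρ = vonNeumannEntropy σ,
      ∃ (D : ℕ → ℕ) (η : ∀ n, Matrix (Fin (D n)) (Fin (D n)) ℂ)
        (U : ∀ n, Matrix ((Fin n → Fin d) × Fin (D n)) ((Fin n → Fin d) × Fin (D n)) ℂ),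
        (fun n => systemSize (D n)) =O[atTop] (fun n : ℕ => Real.sqrt (n * Real.logb 2 n)) ∧
        (∀ n, IsState (η n)) ∧
        (∀ n, U n ∈ Matrix.unitaryGroup ((Fin n → Fin d) × Fin (D n)) ℂ) ∧
        Tendsto (fun n => traceNorm
          (traceAnc (U n * (tensorPower ρ n ⊗ₖ η n) * (U n)ᴴ) - tensorPower σ n)) atTop (𝓝 0),
      ∃ (D : ℕ → ℕ) (η ν : ∀ n, Matrix (Fin (D n)) (Fin (D n)) ℂ)
        (U V : ∀ n, Matrix ((Fin n → Fin d) × Fin (D n)) ((Fin n → Fin d) × Fin (D n)) ℂ),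
        (fun n => systemSize (D n)) =o[atTop] (fun n : ℕ => (n : ℝ)) ∧
        (∀ n, IsState (η n)) ∧ (∀ n, IsState (ν n)) ∧
        (∀ n, U n ∈ Matrix.unitaryGroup ((Fin n → Fin d) × Fin (D n)) ℂ) ∧
        (∀ n, V n ∈ Matrix.unitaryGroup ((Fin n → Fin d) × Fin (D n)) ℂ) ∧
        Tendsto (fun n => traceNorm
          (traceAnc (U n * (tensorPower ρ n ⊗ₖ η n) * (U n)ᴴ -
            V n * (tensorPower σ n ⊗ₖ ν n) * (V n)ᴴ))) atTop (𝓝 0)] := by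

  tfae_have 1 → 2 := exists_catalyst_of_entropy_eq hρ hσ
  tfae_have 2 → 3 := by
    rintro ⟨D, η, U, hD, hη, hU, h⟩
    -- With V = 1 and the same ancilla state, the second partial trace is exactly the tensor power
    -- of σ.
    refine ⟨D, η, η, U, fun _ => 1, hD.trans_isLittleO isLittleO_typicalWidth, hη, hη, hU,
      fun _ => one_mem _, ?_⟩
    simpa [traceAnc_sub, traceAnc_kronecker, (hη _).trace_eq_one] using h
  tfae_have 3 → 1 := by
    rintro ⟨D, η, ν, U, V, hD, hη, hν, hU, hV, h⟩
    refine le_antisymm (vonNeumannEntropy_le_of_tendsto hσ hρ hD hν hη hV hU ?_)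
      (vonNeumannEntropy_le_of_tendsto hρ hσ hD hη hν hU hV h)
    refine h.congr fun n => ?_
    rw [← traceNorm_neg]
    congr 1
    simp [traceAnc_sub]
  tfae_finish
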